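/- Let $\mathcal C$ be a triangulated category. A stability condition $\sigma=(Z,P)$ on $\mathcal C$ (in the sense of Bridgeland) consists of a homomorphism $Z:K_0(\mathcal C)\to\mathbb C$ and full additive subcategories $P(\phi)\subset\mathcal C$ ($\phi\in\mathbb R$), closed under isomorphism, such that $P(\phi+1)=P(\phi)[1]$; $\mathrm{Hom}(A,B)=0$ for $A\in P(\phi_1)$, $B\in P(\phi_2)$, $\phi_1>\phi_2$; every object has a Harder–Narasimhan filtration with factors in categories $P(\phi_i)$ of strictly decreasing phases $\phi_i$; and $Z(E)\in\mathbb R_{>0}\,e^{i\pi\phi}$ for $0\neq E\in P(\phi)$. Its underlying t-structure has aisle $P(>0)$ and heart $P((0,1])$. An object is $\sigma$-stable if it is a simple object of $P(\phi)$ for some $\phi$. The set of stability conditions carries the topology of Bridgeland's generalized metric $$d(\sigma,\tau)=\sup_{E\neq0}\max\Big\{|\phi^+_\sigma(E)-\phi^+_\tau(E)|,\ |\phi^-_\sigma(E)-\phi^-_\tau(E)|,\ \Big|\log\frac{m_\sigma(E)}{m_\tau(E)}\Big|\Big\},$$ where $\phi^\pm_\sigma(E)$ are the largest and smallest phases of the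 Harder–Narasimhan factors $A_i$ of $E$ and $m_\sigma(E)=\sum_i|Z(A_i)|$. The space $\mathrm{Stab}(\mathcal C)$ of locally finite stability conditions is a subspace of it. **Lemma.** Let $\tau$ be a t-structure on $\mathcal C$ whose heart is of finite length with finitely many simple objects up to isomorphism, and let $\sigma$ be a stability condition on $\mathcal C$ whose underlying t-structure is $\tau$. If $F\in\mathcal C$ is $\sigma$-stable, then there is an open neighborhood $U$ of $\sigma$ in the space of all stability conditions on $\mathcal C$ (hence also, if $\sigma$ is locally finite, a neighborhood $U\cap\mathrm{Stab}(\mathcal C)$ in $\mathrm{Stab}(\mathcal C)$) such that $F$ is $\sigma'$-stable for every $\sigma'\in U$. This applies in particular when $\mathcal C=D^b(\mathrm{Coh}_{\mathcal B_e}(X))$ for the resolution $X$ of a Slodowy slice with Springer fibre $\mathcal B_e$, and $\sigma=\iota(z)$ lies in the image of the map $\iota:\widetilde{V^{reg}}\to\mathrm{Stab}(\mathcal C)$: the underlying t-structure of $\iota(z)$ is then a translate, under the affine braid group acting by autoequivalences, of the t-structure attached to an alcove, whose heart is of finite length with finitely many simple objects. -/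

import Mathlib

open CategoryTheory CategoryTheory.Limits CategoryTheory.Pretriangulated
open CategoryTheory.Triangulated
open scoped Topology ENNReal

namespace BridgelandStability

universe v u

section

variable (C : Type u) [Category.{v} C] [HasZeroObject C] [HasShift C ℤ] [Preadditive C]
  [∀ n : ℤ, (shiftFunctor C n).Additive] [Pretriangulated C]

/-- The relations `[Y] - [X] - [Z]`, one for each distinguished triangle `X ⟶ Y ⟶ Z ⟶ X⟦1⟧`. -/
def K0Relations : Set (FreeAbelianGroup C) :=
  {x | ∃ T : Triangle C, T ∈ distTriang C ∧
    x = FreeAbelianGroup.of T.obj₂ - FreeAbelianGroup.of T.obj₁ - FreeAbelianGroup.of T.obj₃}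

/-- The Grothendieck group of a triangulated category. -/
abbrev K0 : Type u := FreeAbelianGroup C ⧸ AddSubgroup.closure (K0Relations C)

variable {C}

/-- The class of an object in the Grothendieck group. -/
def K0.mk (X : C) : K0 C := QuotientAddGroup.mk (FreeAbelianGroup.of X)

/-- `X` is a simple object of the full subcategory `P`, where the short exact sequences in `P`
are the distinguished triangles of `C` whose three vertices are in `P`. This is used when `P` is
the heart of a t-structure, and when `P` is the category of semistable objects of a given phase;
these are abelian categories with exactly these short exact sequences. -/
def IsSimpleIn (P : ObjectProperty C) (X : C) : Prop :=
  P X ∧ ¬ IsZero X ∧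
    ∀ (A B : C) (f : A ⟶ X) (g : X ⟶ B) (h : B ⟶ A⟦(1 : ℤ)⟧),
      Triangle.mk f g h ∈ distTriang C → P A → P B → IsZero A ∨ IsZero B

/-- `X` has a finite filtration whose successive subquotients are in `S`. -/
inductive HasFiltration (S : ObjectProperty C) : C → Prop
  | zero (X : C) (hX : IsZero X) : HasFiltration S X
  | step (A X B : C) (f : A ⟶ X) (g : X ⟶ B) (h : B ⟶ A⟦(1 : ℤ)⟧)
      (hT : Triangle.mk f g h ∈ distTriang C) (hA : HasFiltration S A) (hB : S B) :
      HasFiltration S X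

/-- A heart `P` is of finite length: every object has a composition series. -/
def IsFiniteLength (P : ObjectProperty C) : Prop :=
  ∀ X : C, P X → HasFiltration (IsSimpleIn P) X

/-- `P` has only finitely many simple objects up to isomorphism. -/
def HasFinitelyManySimples (P : ObjectProperty C) : Prop :=
  ∃ s : Set C, s.Finite ∧ ∀ X : C, IsSimpleIn P X → ∃ Y ∈ s, Nonempty (X ≅ Y)

/-- A Harder-Narasimhan filtration of `E`: objects `0 = E₀, E₁, …, Eₙ ≅ E` with distinguished
triangles `Eᵢ ⟶ Eᵢ₊₁ ⟶ Aᵢ ⟶ Eᵢ⟦1⟧`, where `0 ≠ Aᵢ ∈ P(φᵢ)` and `φ₀ > φ₁ > … > φₙ₋₁`. -/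
structure HNFiltration (P : ℝ → ObjectProperty C) (E : C) where
  n : ℕ
  obj : Fin (n + 1) → C
  isZero_obj_zero : IsZero (obj 0)
  isoLast : obj (Fin.last n) ≅ E
  factor : Fin n → C
  phase : Fin n → ℝ
  phase_strictAnti : StrictAnti phase
  factor_mem : ∀ i, P (phase i) (factor i)
  factor_ne_zero : ∀ i, ¬ IsZero (factor i)
  ι : ∀ i : Fin n, obj i.castSucc ⟶ obj i.succ
  π : ∀ i : Fin n, obj i.succ ⟶ factor i
  δ : ∀ i : Fin n, factor i ⟶ (obj i.castSucc)⟦(1 : ℤ)⟧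
  distinguished : ∀ i, Triangle.mk (ι i) (π i) (δ i) ∈ distTriang C

variable (C)

/-- A Bridgeland stability condition `σ = (Z, P)` on `C`: a central charge `Z : K₀(C) → ℂ` and a
slicing `P` such that `Z(E) ∈ ℝ_{>0} · exp(iπφ)` for every nonzero `E ∈ P(φ)`. -/
structure StabilityCondition where
  /-- the central charge -/
  Z : K0 C →+ ℂ
  /-- `P φ` is the full subcategory of semistable objects of phase `φ` -/
  P : ℝ → ObjectProperty C
  prop_of_iso : ∀ (φ : ℝ) {X Y : C}, (X ≅ Y) → P φ X → P φ Y
  prop_of_isZero : ∀ (φ : ℝ) (X : C), IsZero X → P φ X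
  prop_biprod : ∀ (φ : ℝ) (X Y : C), P φ X → P φ Y → P φ (X ⊞ Y)
  shift_iff : ∀ (φ : ℝ) (X : C), P (φ + 1) (X⟦(1 : ℤ)⟧) ↔ P φ X
  hom_eq_zero : ∀ (φ₁ φ₂ : ℝ), φ₂ < φ₁ → ∀ (X Y : C), P φ₁ X → P φ₂ Y → ∀ f : X ⟶ Y, f = 0
  exists_hn : ∀ E : C, Nonempty (HNFiltration P E)
  Z_eq : ∀ (φ : ℝ) (E : C), P φ E → ¬ IsZero E →
    ∃ m : ℝ, 0 < m ∧ Z (K0.mk E) = m * Complex.exp (Real.pi * φ * Complex.I)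

variable {C}

namespace StabilityCondition

noncomputable section

/-- The Harder-Narasimhan filtration of `E` (unique up to isomorphism). -/
def hn (σ : StabilityCondition C) (E : C) : HNFiltration σ.P E := Classical.choice (σ.exists_hn E)

/-- The maximal phase `φ⁺(E)` of a nonzero object. -/
def phiPlus (σ : StabilityCondition C) (E : C) : ℝ := ⨆ i, (σ.hn E).phase i

/-- The minimal phase `φ⁻(E)` of a nonzero object. -/
def phiMinus (σ : StabilityCondition C) (E : C) : ℝ := ⨅ i, (σ.hn E).phase i

/-- The mass of an object: the sum of the `|Z(Aᵢ)|` over its Harder-Narasimhan factors `Aᵢ`. -/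
def mass (σ : StabilityCondition C) (E : C) : ℝ := ∑ i, ‖σ.Z (K0.mk ((σ.hn E).factor i))‖

/-- `E` is `σ`-stable: it is a simple object of `P(φ)` for some phase `φ`. -/
def IsStable (σ : StabilityCondition C) (E : C) : Prop := ∃ φ : ℝ, IsSimpleIn (σ.P φ) E

/-- `t` is the t-structure underlying `σ`: its aisle `t.le 0` is `P(>0)` and `t.ge 1` is `P(≤0)`,
so that its heart is `P((0,1])`. -/
def HasUnderlyingTStructure (σ : StabilityCondition C) (t : TStructure C) : Prop :=
  (∀ X : C, t.le 0 X ↔ ∀ i, 0 < (σ.hn X).phase i) ∧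
    (∀ X : C, t.ge 1 X ↔ ∀ i, (σ.hn X).phase i ≤ 0)

/-- Bridgeland's generalized metric: the supremum over all nonzero objects `E` of
`|φ⁺_σ(E) - φ⁺_τ(E)|`, `|φ⁻_σ(E) - φ⁻_τ(E)|` and `|log (m_σ(E) / m_τ(E))|`. Its topology is the
one of the space of stability conditions; the locally finite stability conditions form a subspace
for the induced topology. -/
instance : PseudoEMetricSpace (StabilityCondition C) where
  edist σ τ := ⨆ E : {E : C // ¬ IsZero E},
    max (edist (σ.phiPlus E.1) (τ.phiPlus E.1))
      (max (edist (σ.phiMinus E.1) (τ.phiMinus E.1))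
        (edist (Real.log (σ.mass E.1)) (Real.log (τ.mass E.1))))
  edist_self σ := by simp
  edist_comm σ τ := by simp only [edist_comm]
  edist_triangle σ τ ρ := by
    refine iSup_le fun E => ?_
    refine le_trans ?_ (add_le_add (le_iSup _ E) (le_iSup _ E))
    refine max_le ?_ (max_le ?_ ?_)
    · exact (edist_triangle _ (τ.phiPlus E.1) _).trans
        (add_le_add (le_max_left _ _) (le_max_left _ _))
    · exact (edist_triangle _ (τ.phiMinus E.1) _).trans
        (add_le_add ((le_max_left _ _).trans (le_max_right _ _))
          ((le_max_left _ _).trans (le_max_right _ _)))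
    · exact (edist_triangle _ (Real.log (τ.mass E.1)) _).trans
        (add_le_add ((le_max_right _ _).trans (le_max_right _ _))
          ((le_max_right _ _).trans (le_max_right _ _)))

end

end StabilityCondition

end

end BridgelandStability

/-!
Stability of an object is an open condition, when the heart of the underlying t-structure is of
finite length with finitely many simple objects.

After a shift, `F` is stable of phase `φ ∈ (0, 1]`. Let `τ` be a stability condition at distance
less than `ε` from `σ` for which `F` is not stable. Then there is a distinguished triangle
`A ⟶ F ⟶ B ⟶ A⟦1⟧` of nonzero objects, with `τ`-phases in `(φ - ε, φ + ε)`, such that the `τ`-phase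
of `A` is at least that of `F` (`exists_destabilizing_triangle`); here the phases of objects are
compared through the sign of `Im (Z(A) * conj Z(F))`. The `σ`-phases of `A` and `B` are in
`(φ - 2ε, φ + 2ε)`. For small `ε` this forces `A` and `B` to be in the heart, even when `φ = 1`: the
finitely many simple objects have phases bounded below by a positive constant, so there are no
nonzero semistable objects with phase slightly above `1` (`exists_phase_gap`).

In the heart, `A` is a proper nonzero subobject of the stable object `F`, so
`Im (Z(A) * conj Z(F)) < 0` for `σ` (`im_neg_of_isSimpleIn`). The class of `A` is a sum of classes
of simple objects. A real functional `c * Im Z - Re Z` which is positive on the simple objects bounds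
the number of summands by its value on `F`, so only finitely many classes of `A` occur
(`finite_sums_of_le`). The central charge of each class depends continuously on the stability
condition (`continuous_Z`), so the strict inequality persists for all these classes in a
neighbourhood of `σ`, which excludes `τ` from it.
-/

namespace BridgelandStability

open scoped ZeroObject ComplexConjugate

universe v u

lemma isZero_shift_iff {C : Type u} [Category.{v} C] [HasShift C ℤ] [Preadditive C]
    [∀ n : ℤ, (shiftFunctor C n).Additive] (X : C) (n : ℤ) : IsZero (X⟦n⟧) ↔ IsZero X := by
  rw [IsZero.iff_id_eq_zero, IsZero.iff_id_eq_zero, ← CategoryTheory.Functor.map_id,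
    (shiftFunctor C n).map_eq_zero_iff]

variable {C : Type u} [Category.{v} C] [HasZeroObject C] [HasShift C ℤ] [Preadditive C]
  [∀ n : ℤ, (shiftFunctor C n).Additive] [Pretriangulated C]

/-! ### Long exact sequences of a triangle given by its morphisms -/

section

variable {A X B : C} {f : A ⟶ X} {g : X ⟶ B} {h : B ⟶ A⟦(1 : ℤ)⟧}

lemma exists_eq_comp_of_comp_eq_zero (hT : Triangle.mk f g h ∈ distTriang C) {Y : C}
    (k : X ⟶ Y) (hk : f ≫ k = 0) : ∃ l : B ⟶ Y, k = g ≫ l :=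
  Triangle.yoneda_exact₂ _ hT k hk

lemma exists_eq_connecting_comp (hT : Triangle.mk f g h ∈ distTriang C) {Y : C}
    (k : B ⟶ Y) (hk : g ≫ k = 0) : ∃ l : A⟦(1 : ℤ)⟧ ⟶ Y, k = h ≫ l :=
  Triangle.yoneda_exact₃ _ hT k hk

lemma exists_eq_lift_comp (hT : Triangle.mk f g h ∈ distTriang C) {Y : C}
    (k : Y ⟶ X) (hk : k ≫ g = 0) : ∃ l : Y ⟶ A, k = l ≫ f :=
  Triangle.coyoneda_exact₂ _ hT k hk

lemma exists_map_eq_comp_connecting (hT : Triangle.mk f g h ∈ distTriang C) {Y : C}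
    (k : Y ⟶ A) (hk : k ≫ f = 0) : ∃ l : Y⟦(1 : ℤ)⟧ ⟶ B, k⟦(1 : ℤ)⟧' = l ≫ h :=
  Triangle.coyoneda_exact₁ _ hT _ (by
    change k⟦(1 : ℤ)⟧' ≫ f⟦(1 : ℤ)⟧' = 0
    rw [← Functor.map_comp, hk, Functor.map_zero])

lemma triangle_of_iso (hT : Triangle.mk f g h ∈ distTriang C) {Y : C} (e : X ≅ Y) :
    Triangle.mk (f ≫ e.hom) (e.inv ≫ g) h ∈ distTriang C := by
  refine isomorphic_distinguished _ hT _
    (Triangle.isoMk _ _ (Iso.refl _) e.symm (Iso.refl _) ?_ ?_ ?_)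
  · change (f ≫ e.hom) ≫ e.inv = 𝟙 A ≫ f
    simp
  · change (e.inv ≫ g) ≫ 𝟙 B = e.inv ≫ g
    simp
  · change h ≫ (𝟙 A)⟦(1 : ℤ)⟧' = 𝟙 B ≫ h
    simp

lemma isIso_of_isZero_left (hT : Triangle.mk f g h ∈ distTriang C) (hA : IsZero A) : IsIso g :=
  (Triangle.isZero₁_iff_isIso₂ _ hT).1 hA

end

/-! ### Classes in the Grothendieck group -/

lemma K0.mk_triangle {A X B : C} {f : A ⟶ X} {g : X ⟶ B} {h : B ⟶ A⟦(1 : ℤ)⟧}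
    (hT : Triangle.mk f g h ∈ distTriang C) : K0.mk X = K0.mk A + K0.mk B := by
  have h0 : (QuotientAddGroup.mk (FreeAbelianGroup.of X - FreeAbelianGroup.of A -
      FreeAbelianGroup.of B) : K0 C) = 0 :=
    (QuotientAddGroup.eq_zero_iff _).2 (AddSubgroup.subset_closure ⟨_, hT, rfl⟩)
  have h1 : K0.mk X - K0.mk A - K0.mk B = 0 := h0
  rw [sub_sub, sub_eq_zero] at h1
  exact h1

lemma K0.mk_eq_zero {X : C} (hX : IsZero X) : K0.mk X = 0 := by
  have hT : Triangle.mk (𝟙 X) (0 : X ⟶ X) (0 : X ⟶ X⟦(1 : ℤ)⟧) ∈ distTriang C :=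
    (Triangle.distinguished_iff_of_isZero₃ _ hX).2 (inferInstanceAs (IsIso (𝟙 X)))
  simpa using K0.mk_triangle hT

lemma K0.mk_congr {X Y : C} (e : X ≅ Y) : K0.mk X = K0.mk Y := by
  have hT : Triangle.mk e.hom (0 : Y ⟶ 0) (0 : (0 : C) ⟶ X⟦(1 : ℤ)⟧) ∈ distTriang C :=
    (Triangle.distinguished_iff_of_isZero₃ _ (isZero_zero C)).2 (inferInstanceAs (IsIso e.hom))
  rw [K0.mk_triangle hT, K0.mk_eq_zero (isZero_zero C), add_zero]

lemma HNFiltration.mk_eq_sum {P : ℝ → ObjectProperty C} {E : C} (H : HNFiltration P E) :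
    K0.mk E = ∑ i, K0.mk (H.factor i) := by
  have h1 : ∀ i, K0.mk (H.factor i) = K0.mk (H.obj i.succ) - K0.mk (H.obj i.castSucc) :=
    fun i => by rw [K0.mk_triangle (H.distinguished i), add_sub_cancel_left]
  have h2 := Fin.sum_univ_succ fun i => K0.mk (H.obj i)
  rw [Fin.sum_univ_castSucc, K0.mk_eq_zero H.isZero_obj_zero, zero_add] at h2
  rw [Finset.sum_congr rfl fun i _ => h1 i, Finset.sum_sub_distrib, ← h2, add_sub_cancel_left,
    K0.mk_congr H.isoLast]

namespace StabilityCondition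

/-! ### Orthogonality and Harder-Narasimhan phases -/

/-- `X` is left orthogonal to all semistable objects with phase in `I`. For a lower set `I` this
says that no Harder-Narasimhan phase of `X` is in `I`. -/
def LeftOrth (σ : StabilityCondition C) (I : Set ℝ) (X : C) : Prop :=
  ∀ ψ ∈ I, ∀ Y, σ.P ψ Y → ∀ f : X ⟶ Y, f = 0

/-- `X` is right orthogonal to all semistable objects with phase in `I`. For an upper set `I` this
says that no Harder-Narasimhan phase of `X` is in `I`. -/
def RightOrth (σ : StabilityCondition C) (I : Set ℝ) (X : C) : Prop :=
  ∀ ψ ∈ I, ∀ Y, σ.P ψ Y → ∀ f : Y ⟶ X, f = 0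

variable {σ : StabilityCondition C}

lemma LeftOrth.of_iso {I : Set ℝ} {X X' : C} (h : σ.LeftOrth I X) (e : X ≅ X') :
    σ.LeftOrth I X' := fun ψ hψ Y hY f => by
  rw [← cancel_epi e.hom, comp_zero]
  exact h ψ hψ Y hY _

lemma RightOrth.of_iso {I : Set ℝ} {X X' : C} (h : σ.RightOrth I X) (e : X ≅ X') :
    σ.RightOrth I X' := fun ψ hψ Y hY f => by
  rw [← cancel_mono e.inv, zero_comp]
  exact h ψ hψ Y hY _

lemma exists_iso_shift {φ : ℝ} {Y : C} (hY : σ.P φ Y) :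
    ∃ Y', σ.P (φ - 1) Y' ∧ Nonempty (Y ≅ Y'⟦(1 : ℤ)⟧) := by
  refine ⟨Y⟦(-1 : ℤ)⟧, ?_, ⟨((shiftEquiv C (1 : ℤ)).counitIso.app Y).symm⟩⟩
  rw [← σ.shift_iff, sub_add_cancel]
  exact σ.prop_of_iso _ ((shiftEquiv C (1 : ℤ)).counitIso.app Y).symm hY

lemma leftOrth_shift_iff {I : Set ℝ} {X : C} :
    σ.LeftOrth I (X⟦(1 : ℤ)⟧) ↔ σ.LeftOrth {ψ | ψ + 1 ∈ I} X := by
  constructor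
  · intro h ψ hψ Y hY f
    rw [← (shiftFunctor C (1 : ℤ)).map_eq_zero_iff]
    exact h (ψ + 1) hψ _ ((σ.shift_iff _ _).2 hY) _
  · intro h ψ hψ Y hY f
    obtain ⟨Y', hY', ⟨e⟩⟩ := exists_iso_shift hY
    rw [← cancel_mono e.hom, zero_comp,
      ← (shiftFunctor C (1 : ℤ)).map_preimage (f ≫ e.hom),
      h (ψ - 1) (by simpa using hψ) _ hY' ((shiftFunctor C (1 : ℤ)).preimage (f ≫ e.hom)),
      Functor.map_zero]

lemma rightOrth_shift_iff {I : Set ℝ} {X : C} :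
    σ.RightOrth I (X⟦(1 : ℤ)⟧) ↔ σ.RightOrth {ψ | ψ + 1 ∈ I} X := by
  constructor
  · intro h ψ hψ Y hY f
    rw [← (shiftFunctor C (1 : ℤ)).map_eq_zero_iff]
    exact h (ψ + 1) hψ _ ((σ.shift_iff _ _).2 hY) _
  · intro h ψ hψ Y hY f
    obtain ⟨Y', hY', ⟨e⟩⟩ := exists_iso_shift hY
    rw [← cancel_epi e.inv, comp_zero,
      ← (shiftFunctor C (1 : ℤ)).map_preimage (e.inv ≫ f),
      h (ψ - 1) (by simpa using hψ) _ hY' ((shiftFunctor C (1 : ℤ)).preimage (e.inv ≫ f)),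
      Functor.map_zero]

lemma leftOrth_of_mem {φ : ℝ} {X : C} (hX : σ.P φ X) {I : Set ℝ} (h : ∀ ψ ∈ I, ψ < φ) :
    σ.LeftOrth I X :=
  fun ψ hψ Y hY f => σ.hom_eq_zero φ ψ (h ψ hψ) X Y hX hY f

lemma rightOrth_of_mem {φ : ℝ} {X : C} (hX : σ.P φ X) {I : Set ℝ} (h : ∀ ψ ∈ I, φ < ψ) :
    σ.RightOrth I X :=
  fun ψ hψ Y hY f => σ.hom_eq_zero ψ φ (h ψ hψ) Y X hY hX f

lemma leftOrth_obj {E : C} (H : HNFiltration σ.P E) {I : Set ℝ}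
    (h : ∀ i, ∀ ψ ∈ I, ψ < H.phase i) (k : Fin (H.n + 1)) : σ.LeftOrth I (H.obj k) := by
  induction k using Fin.induction with
  | zero => exact fun _ _ _ _ f => H.isZero_obj_zero.eq_of_src f 0
  | succ i ih =>
    intro ψ hψ Y hY f
    obtain ⟨g, rfl⟩ := exists_eq_comp_of_comp_eq_zero (H.distinguished i) f (ih ψ hψ Y hY _)
    rw [leftOrth_of_mem (H.factor_mem i) (h i) ψ hψ Y hY g, comp_zero]

lemma rightOrth_obj {E : C} (H : HNFiltration σ.P E) {I : Set ℝ}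
    (h : ∀ i, ∀ ψ ∈ I, H.phase i < ψ) (k : Fin (H.n + 1)) : σ.RightOrth I (H.obj k) := by
  induction k using Fin.induction with
  | zero => exact fun _ _ _ _ f => H.isZero_obj_zero.eq_of_tgt f 0
  | succ i ih =>
    intro ψ hψ Y hY f
    obtain ⟨g, rfl⟩ := exists_eq_lift_comp (H.distinguished i) f
      (rightOrth_of_mem (H.factor_mem i) (h i) ψ hψ Y hY _)
    rw [ih ψ hψ Y hY g, zero_comp]

/-- If `π i` vanished, the identity of the factor `A i` would factor through `(E i)⟦1⟧`, all of
whose phases exceed that of `A i`. -/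
lemma pi_ne_zero {E : C} (H : HNFiltration σ.P E) (i : Fin H.n) : H.π i ≠ 0 := by
  intro h0
  refine H.factor_ne_zero i ((IsZero.iff_id_eq_zero _).2 ?_)
  obtain ⟨g, hg⟩ := exists_eq_connecting_comp (H.distinguished i) (𝟙 (H.factor i))
    (by rw [Category.comp_id, h0])
  have hobj : ∀ k : Fin (H.n + 1), k ≤ i.castSucc →
      σ.LeftOrth (Set.Iio (H.phase i)) (H.obj k) := by
    intro k
    induction k using Fin.induction with
    | zero => exact fun _ _ _ _ _ f => H.isZero_obj_zero.eq_of_src f 0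
    | succ j ih =>
      intro hj ψ hψ Y hY f
      have hji : j < i := Fin.lt_def.2 (Nat.lt_of_succ_le (Fin.le_def.1 hj))
      obtain ⟨g, rfl⟩ := exists_eq_comp_of_comp_eq_zero (H.distinguished j) f
        (ih ((Fin.castSucc_lt_castSucc_iff.2 hji).le) ψ hψ Y hY _)
      rw [σ.hom_eq_zero _ _ (lt_trans hψ (H.phase_strictAnti hji)) _ _ (H.factor_mem j) hY g,
        comp_zero]
  have hg0 : g = 0 := by
    refine leftOrth_shift_iff (I := Set.Iio (H.phase i + 1)).2 (fun ψ hψ => ?_)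
      (H.phase i) (by simp) _ (H.factor_mem i) g
    exact hobj _ le_rfl ψ (by simpa using hψ)
  rw [hg, hg0, comp_zero]

/-- The last factor is a nonzero quotient of `E` with the least phase. -/
lemma notMem_of_leftOrth {E : C} (H : HNFiltration σ.P E) {I : Set ℝ} (hI : IsLowerSet I)
    (h : σ.LeftOrth I E) (i : Fin H.n) : H.phase i ∉ I := by
  intro hi
  have hpos : 0 < H.n := i.pos
  let j : Fin H.n := ⟨H.n - 1, by omega⟩
  have hj : j.succ = Fin.last H.n := by
    ext
    simp only [j, Fin.val_succ, Fin.val_last]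
    omega
  have hjI : H.phase j ∈ I :=
    hI (H.phase_strictAnti.antitone (Fin.le_def.2 (by simp only [j]; omega))) hi
  have h' : σ.LeftOrth I (H.obj j.succ) := by
    rw [hj]
    exact h.of_iso H.isoLast.symm
  exact pi_ne_zero H j (h' _ hjI _ (H.factor_mem j) _)

/-- A morphism from the first factor `A 0` which dies in `E (k+1)` comes from `(A k)⟦-1⟧`, whose
phase is less than that of `A 0`. So `A 0 ≅ E 1` has a nonzero morphism to `E`. -/
lemma notMem_of_rightOrth {E : C} (H : HNFiltration σ.P E) {I : Set ℝ} (hI : IsUpperSet I)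
    (h : σ.RightOrth I E) (i : Fin H.n) : H.phase i ∉ I := by
  intro hi
  have hpos : 0 < H.n := i.pos
  let j : Fin H.n := ⟨0, hpos⟩
  have hle : ∀ k, H.phase k ≤ H.phase j := fun k =>
    H.phase_strictAnti.antitone (Fin.le_def.2 (Nat.zero_le _))
  have hjI : H.phase j ∈ I := hI (hle i) hi
  have key : ∀ k, ∀ f : H.factor j ⟶ H.obj k, f = 0 := by
    intro k
    induction k using Fin.reverseInduction with
    | last => exact (h.of_iso H.isoLast.symm) _ hjI _ (H.factor_mem j)
    | cast k ih =>
      intro f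
      rw [← (shiftFunctor C (1 : ℤ)).map_eq_zero_iff]
      obtain ⟨g, hg⟩ := exists_map_eq_comp_connecting (H.distinguished k) f
        (ih (f ≫ H.ι k))
      have hg0 : g = 0 := σ.hom_eq_zero (H.phase j + 1) (H.phase k)
        (by linarith [hle k]) _ _ ((σ.shift_iff _ _).2 (H.factor_mem j)) (H.factor_mem k) g
      rw [hg, hg0, zero_comp]
  have hz : IsZero (H.obj j.castSucc) := H.isZero_obj_zero
  have : IsIso (H.π j) := isIso_of_isZero_left (H.distinguished j) hz
  have h0 : inv (H.π j) = 0 := key _ _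
  refine H.factor_ne_zero j ((IsZero.iff_id_eq_zero _).2 ?_)
  rw [← IsIso.inv_hom_id (H.π j), h0, zero_comp]

lemma leftOrth_of_phase_gt {E : C} (H : HNFiltration σ.P E) {I : Set ℝ}
    (h : ∀ i, ∀ ψ ∈ I, ψ < H.phase i) : σ.LeftOrth I E :=
  (leftOrth_obj H h (Fin.last _)).of_iso H.isoLast

lemma leftOrth_iff {E : C} (H : HNFiltration σ.P E) {I : Set ℝ} (hI : IsLowerSet I) :
    σ.LeftOrth I E ↔ ∀ i, H.phase i ∉ I := by
  refine ⟨notMem_of_leftOrth H hI, fun h => leftOrth_of_phase_gt H (fun i ψ hψ => ?_)⟩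
  by_contra! hle
  exact h i (hI hle hψ)

lemma rightOrth_iff {E : C} (H : HNFiltration σ.P E) {I : Set ℝ} (hI : IsUpperSet I) :
    σ.RightOrth I E ↔ ∀ i, H.phase i ∉ I := by
  refine ⟨notMem_of_rightOrth H hI, fun h => ?_⟩
  refine (rightOrth_obj H (fun i ψ hψ => ?_) (Fin.last _)).of_iso H.isoLast
  by_contra! hle
  exact h i (hI hle hψ)

lemma n_pos_of_not_isZero {E : C} (H : HNFiltration σ.P E) (hE : ¬ IsZero E) : 0 < H.n := by
  by_contra h0
  have h0 : H.n = 0 := by omega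
  have hl : Fin.last H.n = 0 := by ext; simpa using h0
  exact hE ((hl ▸ H.isZero_obj_zero : IsZero (H.obj (Fin.last H.n))).of_iso H.isoLast.symm)

lemma phase_eq_of_mem {φ : ℝ} {E : C} (hE : σ.P φ E) (H : HNFiltration σ.P E) (i : Fin H.n) :
    H.phase i = φ := by
  have h1 := (leftOrth_iff H (isLowerSet_Iio φ)).1 (leftOrth_of_mem hE fun _ h => h) i
  have h2 := (rightOrth_iff H (isUpperSet_Ioi φ)).1 (rightOrth_of_mem hE fun _ h => h) i
  simp only [Set.mem_Iio, Set.mem_Ioi, not_lt] at h1 h2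
  exact le_antisymm h2 h1

/-- Phases are strictly decreasing, so there is at most one factor of phase `φ`. -/
lemma mem_of_phase_eq {φ : ℝ} {E : C} (H : HNFiltration σ.P E) (h : ∀ i, H.phase i = φ) :
    σ.P φ E := by
  by_cases hE : IsZero E
  · exact σ.prop_of_isZero φ E hE
  have hpos := n_pos_of_not_isZero H hE
  let j : Fin H.n := ⟨0, hpos⟩
  have hz : IsZero (H.obj j.castSucc) := H.isZero_obj_zero
  have : IsIso (H.π j) := isIso_of_isZero_left (H.distinguished j) hz
  have hl : Fin.last H.n = j.succ := by
    ext
    simp only [j, Fin.val_succ, Fin.val_last, zero_add]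
    by_contra hne
    have hlt : j < (⟨1, by omega⟩ : Fin H.n) := Fin.lt_def.2 Nat.zero_lt_one
    have := H.phase_strictAnti hlt
    rw [h, h] at this
    exact lt_irrefl _ this
  have e : H.obj j.succ ≅ E := hl ▸ H.isoLast
  exact σ.prop_of_iso φ ((asIso (H.π j)).symm ≪≫ e) (h j ▸ H.factor_mem j)

/-! ### Extremal phases -/

lemma phase_le_phiPlus (E : C) (i : Fin (σ.hn E).n) : (σ.hn E).phase i ≤ σ.phiPlus E :=
  le_ciSup (Set.finite_range _).bddAbove i

lemma phiMinus_le_phase (E : C) (i : Fin (σ.hn E).n) : σ.phiMinus E ≤ (σ.hn E).phase i :=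
  ciInf_le (Set.finite_range _).bddBelow i

lemma exists_phase_eq_phiPlus {E : C} (hE : ¬ IsZero E) :
    ∃ i, (σ.hn E).phase i = σ.phiPlus E := by
  have : Nonempty (Fin (σ.hn E).n) := ⟨⟨0, n_pos_of_not_isZero _ hE⟩⟩
  exact exists_eq_ciSup_of_finite

lemma exists_phase_eq_phiMinus {E : C} (hE : ¬ IsZero E) :
    ∃ i, (σ.hn E).phase i = σ.phiMinus E := by
  have : Nonempty (Fin (σ.hn E).n) := ⟨⟨0, n_pos_of_not_isZero _ hE⟩⟩
  exact exists_eq_ciInf_of_finite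

lemma phiPlus_eq_of_mem {φ : ℝ} {E : C} (hE : σ.P φ E) (h0 : ¬ IsZero E) : σ.phiPlus E = φ := by
  obtain ⟨i, hi⟩ := exists_phase_eq_phiPlus (σ := σ) h0
  rw [← hi, phase_eq_of_mem hE]

lemma phiMinus_eq_of_mem {φ : ℝ} {E : C} (hE : σ.P φ E) (h0 : ¬ IsZero E) :
    σ.phiMinus E = φ := by
  obtain ⟨i, hi⟩ := exists_phase_eq_phiMinus (σ := σ) h0
  rw [← hi, phase_eq_of_mem hE]

/-! ### Shifts of stable objects -/

lemma mem_shift_iff (φ : ℝ) (X : C) (n : ℤ) : σ.P (φ + n) (X⟦n⟧) ↔ σ.P φ X := by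
  have key : ∀ (n : ℤ), σ.P (φ + (n + 1 : ℤ)) (X⟦n + 1⟧) ↔ σ.P (φ + n) (X⟦n⟧) := by
    intro n
    rw [← σ.shift_iff (φ + n)]
    have e : (X⟦n⟧)⟦(1 : ℤ)⟧ ≅ X⟦n + 1⟧ := ((shiftFunctorAdd C n 1).app X).symm
    push_cast
    rw [add_assoc]
    exact ⟨σ.prop_of_iso _ e.symm, σ.prop_of_iso _ e⟩
  induction n using Int.induction_on with
  | zero =>
    simp only [Int.cast_zero, add_zero]
    exact ⟨σ.prop_of_iso _ ((shiftFunctorZero C ℤ).app X),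
      σ.prop_of_iso _ ((shiftFunctorZero C ℤ).app X).symm⟩
  | succ n ih => exact (key n).trans ih
  | pred n ih =>
    refine Iff.trans ?_ ih
    rw [← key, sub_add_cancel]

lemma IsStable.of_shift {F : C} {n : ℤ} (h : σ.IsStable (F⟦n⟧)) : σ.IsStable F := by
  obtain ⟨φ, hF, h0, hs⟩ := h
  refine ⟨φ - n, ?_, fun hz => h0 ((isZero_shift_iff F n).2 hz), ?_⟩
  · rw [← mem_shift_iff _ _ n, sub_add_cancel]
    exact hF
  · intro A B f g h hT hA hB
    have hT' := Triangle.shift_distinguished _ hT n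
    rw [← isZero_shift_iff A n, ← isZero_shift_iff B n]
    rw [← mem_shift_iff _ _ n, sub_add_cancel] at hA hB
    exact hs _ _ _ _ _ hT' hA hB

lemma IsStable.of_iso {F G : C} (e : F ≅ G) (h : σ.IsStable F) : σ.IsStable G := by
  obtain ⟨φ, hF, h0, hs⟩ := h
  refine ⟨φ, σ.prop_of_iso φ e hF, fun hz => h0 (hz.of_iso e), ?_⟩
  intro A B f g h hT hA hB
  have hT' : Triangle.mk (f ≫ e.symm.hom) (e.symm.inv ≫ g) h ∈ distTriang C :=
    triangle_of_iso hT e.symm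
  exact hs A B _ _ h hT' hA hB

lemma isStable_shift_iff {F : C} (n : ℤ) : σ.IsStable (F⟦n⟧) ↔ σ.IsStable F :=
  ⟨IsStable.of_shift, fun h =>
    IsStable.of_shift (n := -n) (h.of_iso ((shiftEquiv C n).unitIso.app F))⟩

end StabilityCondition

/-! ### The unit vector of a phase -/

/-- The unit vector `exp(iπφ)`. -/
noncomputable def phaseVec (φ : ℝ) : ℂ := Complex.exp (Real.pi * φ * Complex.I)

lemma phaseVec_eq (φ : ℝ) : phaseVec φ = Complex.exp (Complex.I * (Real.pi * φ : ℝ)) := by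
  rw [phaseVec, mul_comm]
  push_cast
  rfl

lemma norm_phaseVec (φ : ℝ) : ‖phaseVec φ‖ = 1 := by
  rw [phaseVec_eq, Complex.norm_exp_I_mul_ofReal]

lemma phaseVec_re (φ : ℝ) : (phaseVec φ).re = Real.cos (Real.pi * φ) := by
  rw [phaseVec_eq, mul_comm, Complex.exp_ofReal_mul_I_re]

lemma phaseVec_im (φ : ℝ) : (phaseVec φ).im = Real.sin (Real.pi * φ) := by
  rw [phaseVec_eq, mul_comm, Complex.exp_ofReal_mul_I_im]

lemma phaseVec_mul_conj_im (α β : ℝ) :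
    (phaseVec α * conj (phaseVec β)).im = Real.sin (Real.pi * (α - β)) := by
  rw [Complex.mul_im, Complex.conj_re, Complex.conj_im, phaseVec_re, phaseVec_re, phaseVec_im,
    phaseVec_im, mul_sub, Real.sin_sub]
  ring

lemma norm_phaseVec_sub_le (α β : ℝ) : ‖phaseVec α - phaseVec β‖ ≤ Real.pi * |α - β| := by
  have h : phaseVec α - phaseVec β =
      phaseVec β * (Complex.exp (Complex.I * (Real.pi * (α - β) : ℝ)) - 1) := by
    rw [phaseVec_eq, phaseVec_eq, mul_sub, ← Complex.exp_add, mul_one]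
    congr 2
    push_cast
    ring
  rw [h, norm_mul, norm_phaseVec, one_mul]
  refine (Real.norm_exp_I_mul_ofReal_sub_one_le).trans ?_
  rw [Real.norm_eq_abs, abs_mul, abs_of_pos Real.pi_pos]

namespace StabilityCondition

variable {σ : StabilityCondition C}

/-! ### Central charges and Harder-Narasimhan factors -/

lemma norm_Z_pos {φ : ℝ} {E : C} (hE : σ.P φ E) (h0 : ¬ IsZero E) : 0 < ‖σ.Z (K0.mk E)‖ := by
  obtain ⟨m, hm, h⟩ := σ.Z_eq φ E hE h0
  rw [h, norm_mul, ← phaseVec, norm_phaseVec, Complex.norm_real, Real.norm_eq_abs, abs_of_pos hm,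
    mul_one]
  exact hm

lemma Z_eq_norm_mul {φ : ℝ} {E : C} (hE : σ.P φ E) (h0 : ¬ IsZero E) :
    σ.Z (K0.mk E) = (‖σ.Z (K0.mk E)‖ : ℝ) * phaseVec φ := by
  obtain ⟨m, hm, h⟩ := σ.Z_eq φ E hE h0
  have hn : ‖σ.Z (K0.mk E)‖ = m := by
    rw [h, norm_mul, ← phaseVec, norm_phaseVec, Complex.norm_real, Real.norm_eq_abs,
      abs_of_pos hm, mul_one]
  rw [hn]
  exact h

lemma norm_Z_factor_pos {E : C} (H : HNFiltration σ.P E) (i : Fin H.n) :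
    0 < ‖σ.Z (K0.mk (H.factor i))‖ :=
  norm_Z_pos (H.factor_mem i) (H.factor_ne_zero i)

lemma Z_eq_sum {E : C} (H : HNFiltration σ.P E) :
    σ.Z (K0.mk E) = ∑ i, (‖σ.Z (K0.mk (H.factor i))‖ : ℝ) * phaseVec (H.phase i) := by
  rw [H.mk_eq_sum, map_sum]
  exact Finset.sum_congr rfl fun i _ => Z_eq_norm_mul (H.factor_mem i) (H.factor_ne_zero i)

lemma Z_mul_conj_im_eq_sum {E : C} (H : HNFiltration σ.P E) (b β : ℝ) :
    (σ.Z (K0.mk E) * conj ((b : ℂ) * phaseVec β)).im =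
      ∑ i, ‖σ.Z (K0.mk (H.factor i))‖ * (b * Real.sin (Real.pi * (H.phase i - β))) := by
  rw [Z_eq_sum H, Finset.sum_mul, Complex.im_sum]
  refine Finset.sum_congr rfl fun i _ => ?_
  rw [map_mul, Complex.conj_ofReal, ← phaseVec_mul_conj_im, mul_mul_mul_comm, ← Complex.ofReal_mul,
    Complex.im_ofReal_mul, mul_assoc]

lemma mass_pos {E : C} (hE : ¬ IsZero E) : 0 < σ.mass E :=
  Finset.sum_pos (fun i _ => norm_Z_factor_pos _ i) ⟨⟨0, n_pos_of_not_isZero _ hE⟩, Finset.mem_univ _⟩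

lemma Z_eq_mass_mul {φ : ℝ} {E : C} (hE : σ.P φ E) :
    σ.Z (K0.mk E) = (σ.mass E : ℝ) * phaseVec φ := by
  rw [Z_eq_sum (σ.hn E), mass, Complex.ofReal_sum, Finset.sum_mul]
  exact Finset.sum_congr rfl fun i _ => by rw [phase_eq_of_mem hE]

lemma norm_Z_sub_mass_mul_le (E : C) (φ : ℝ) :
    ‖σ.Z (K0.mk E) - (σ.mass E : ℝ) * phaseVec φ‖ ≤
      σ.mass E * (Real.pi * (|σ.phiPlus E - φ| + |σ.phiMinus E - φ|)) := by
  rw [Z_eq_sum (σ.hn E), mass, Complex.ofReal_sum, Finset.sum_mul, Finset.sum_mul,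
    ← Finset.sum_sub_distrib]
  refine norm_sum_le_of_le _ fun i _ => ?_
  rw [← mul_sub, norm_mul, Complex.norm_real, norm_norm]
  gcongr
  refine (norm_phaseVec_sub_le _ _).trans ?_
  gcongr
  have h1 := phase_le_phiPlus (σ := σ) E i
  have h2 := phiMinus_le_phase (σ := σ) E i
  rw [abs_le]
  constructor
  · have := neg_abs_le (σ.phiMinus E - φ)
    have := abs_nonneg (σ.phiPlus E - φ)
    linarith
  · have := le_abs_self (σ.phiPlus E - φ)
    have := abs_nonneg (σ.phiMinus E - φ)
    linarith

/-! ### Continuity of phases, masses and central charges -/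

lemma edist_phiPlus_le (σ τ : StabilityCondition C) {E : C} (hE : ¬ IsZero E) :
    edist (σ.phiPlus E) (τ.phiPlus E) ≤ edist σ τ :=
  (le_max_left _ _).trans
    (le_iSup (fun E : {E : C // ¬ IsZero E} => max (edist (σ.phiPlus E.1) (τ.phiPlus E.1))
      (max (edist (σ.phiMinus E.1) (τ.phiMinus E.1))
        (edist (Real.log (σ.mass E.1)) (Real.log (τ.mass E.1))))) ⟨E, hE⟩)

lemma edist_phiMinus_le (σ τ : StabilityCondition C) {E : C} (hE : ¬ IsZero E) :
    edist (σ.phiMinus E) (τ.phiMinus E) ≤ edist σ τ :=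
  ((le_max_left _ _).trans (le_max_right _ _)).trans
    (le_iSup (fun E : {E : C // ¬ IsZero E} => max (edist (σ.phiPlus E.1) (τ.phiPlus E.1))
      (max (edist (σ.phiMinus E.1) (τ.phiMinus E.1))
        (edist (Real.log (σ.mass E.1)) (Real.log (τ.mass E.1))))) ⟨E, hE⟩)

lemma edist_log_mass_le (σ τ : StabilityCondition C) {E : C} (hE : ¬ IsZero E) :
    edist (Real.log (σ.mass E)) (Real.log (τ.mass E)) ≤ edist σ τ :=
  ((le_max_right _ _).trans (le_max_right _ _)).trans
    (le_iSup (fun E : {E : C // ¬ IsZero E} => max (edist (σ.phiPlus E.1) (τ.phiPlus E.1))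
      (max (edist (σ.phiMinus E.1) (τ.phiMinus E.1))
        (edist (Real.log (σ.mass E.1)) (Real.log (τ.mass E.1))))) ⟨E, hE⟩)

lemma continuous_phiPlus {E : C} (hE : ¬ IsZero E) :
    Continuous fun σ : StabilityCondition C => σ.phiPlus E :=
  (LipschitzWith.of_edist_le fun σ τ => edist_phiPlus_le σ τ hE).continuous

lemma continuous_phiMinus {E : C} (hE : ¬ IsZero E) :
    Continuous fun σ : StabilityCondition C => σ.phiMinus E :=
  (LipschitzWith.of_edist_le fun σ τ => edist_phiMinus_le σ τ hE).continuous

lemma continuous_mass {E : C} (hE : ¬ IsZero E) :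
    Continuous fun σ : StabilityCondition C => σ.mass E := by
  have h : Continuous fun σ : StabilityCondition C => Real.log (σ.mass E) :=
    (LipschitzWith.of_edist_le fun σ τ => edist_log_mass_le σ τ hE).continuous
  exact (Real.continuous_exp.comp h).congr fun σ => Real.exp_log (mass_pos hE)

/-- The phases of a `σ`-semistable object with respect to a nearby `τ` lie in a narrow sector, so
its central charge is close to the mass times a fixed unit vector. -/
lemma continuousAt_Z_of_mem {φ : ℝ} {E : C} (hE : σ.P φ E) (h0 : ¬ IsZero E) :
    ContinuousAt (fun τ : StabilityCondition C => τ.Z (K0.mk E)) σ := by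
  have hm : ContinuousAt (fun τ : StabilityCondition C => ((τ.mass E : ℝ) : ℂ) * phaseVec φ) σ :=
    ((Complex.continuous_ofReal.comp (continuous_mass h0)).mul continuous_const).continuousAt
  have hb : Filter.Tendsto (fun τ : StabilityCondition C =>
      τ.mass E * (Real.pi * (|τ.phiPlus E - φ| + |τ.phiMinus E - φ|))) (𝓝 σ) (𝓝 0) := by
    have hc : Continuous fun τ : StabilityCondition C =>
        τ.mass E * (Real.pi * (|τ.phiPlus E - φ| + |τ.phiMinus E - φ|)) :=
      (continuous_mass h0).mul (continuous_const.mul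
        ((((continuous_phiPlus h0).sub continuous_const).abs).add
          ((continuous_phiMinus h0).sub continuous_const).abs))
    simpa [phiPlus_eq_of_mem hE h0, phiMinus_eq_of_mem hE h0] using hc.tendsto σ
  have hd : Filter.Tendsto (fun τ : StabilityCondition C =>
      τ.Z (K0.mk E) - ((τ.mass E : ℝ) : ℂ) * phaseVec φ) (𝓝 σ) (𝓝 0) :=
    squeeze_zero_norm (fun τ => norm_Z_sub_mass_mul_le E φ) hb
  have := hd.add hm.tendsto
  simpa [ContinuousAt, Z_eq_mass_mul hE] using this

lemma continuous_Z (k : K0 C) : Continuous fun σ : StabilityCondition C => σ.Z k := by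
  refine continuous_iff_continuousAt.2 fun σ => ?_
  have hmk : ∀ E : C, ContinuousAt (fun τ : StabilityCondition C => τ.Z (K0.mk E)) σ := by
    intro E
    simp only [(σ.hn E).mk_eq_sum, map_sum]
    exact tendsto_finsetSum _ fun i _ =>
      continuousAt_Z_of_mem ((σ.hn E).factor_mem i) ((σ.hn E).factor_ne_zero i)
  obtain ⟨x, rfl⟩ := QuotientAddGroup.mk_surjective k
  induction x using FreeAbelianGroup.induction_on with
  | zero =>
    simp only [QuotientAddGroup.mk_zero, map_zero]
    exact continuousAt_const
  | of E => exact hmk E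
  | neg E _ =>
    simp only [QuotientAddGroup.mk_neg, map_neg]
    exact (hmk E).neg
  | add x y hx hy =>
    simp only [QuotientAddGroup.mk_add, map_add]
    exact hx.add hy

end StabilityCondition

/-! ### Sums of classes with bounded degree -/

lemma length_mul_le_map_sum {M : Type*} [AddCommMonoid M] {lam : M →+ ℝ} {δ : ℝ} {l : List M}
    (hl : ∀ g ∈ l, δ ≤ lam g) : l.length * δ ≤ lam l.sum := by
  induction l with
  | nil => simp
  | cons a l ih =>
    have h1 := hl a (by simp)
    have h2 := ih fun g hg => hl g (by simp [hg])
    simp only [List.length_cons, List.sum_cons, map_add]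
    push_cast
    linarith

/-- If `lam ≥ δ > 0` on a finite set `G`, then a bound for `lam` on a sum of elements of `G` bounds
the number of summands. -/
lemma finite_sums_of_le {M : Type*} [AddCommMonoid M] {G : Set M} (hG : G.Finite)
    {lam : M →+ ℝ} {δ : ℝ} (hδ : 0 < δ) (hlam : ∀ g ∈ G, δ ≤ lam g) (b : ℝ) :
    {k : M | lam k ≤ b ∧ ∃ l : List M, (∀ g ∈ l, g ∈ G) ∧ l.sum = k}.Finite := by
  have : Finite G := hG
  refine ((List.finite_length_le G ⌊b / δ⌋₊).image fun l => (l.map Subtype.val).sum).subset ?_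
  rintro _ ⟨hb, l, hl, rfl⟩
  refine ⟨l.attach.map fun g => ⟨g.1, hl g.1 g.2⟩, ?_, ?_⟩
  · simp only [Set.mem_ofPred_eq, List.length_map, List.length_attach]
    refine Nat.le_floor ((le_div_iff₀ hδ).2 ?_)
    exact (length_mul_le_map_sum fun g hg => hlam g (hl g hg)).trans hb
  · simp [List.map_map, Function.comp_def]

/-- The list consists of the classes of the subquotients of the filtration. -/
lemma HasFiltration.exists_list {S : ObjectProperty C} {X : C} (h : HasFiltration S X) :
    ∃ l : List (K0 C), (∀ g ∈ l, g ∈ K0.mk '' {Y | S Y}) ∧ l.sum = K0.mk X ∧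
      (l = [] → IsZero X) := by
  induction h with
  | zero X hX => exact ⟨[], by simp, by rw [K0.mk_eq_zero hX, List.sum_nil], fun _ => hX⟩
  | step A X B f g h hT hA hB ih =>
    obtain ⟨l, hl, hs, -⟩ := ih
    refine ⟨K0.mk B :: l, ?_, ?_, by simp⟩
    · intro g hg
      rcases List.mem_cons.1 hg with rfl | hg
      exacts [⟨B, hB, rfl⟩, hl g hg]
    · rw [List.sum_cons, hs, K0.mk_triangle hT, add_comm]

lemma HasFinitelyManySimples.finite_classes {P : ObjectProperty C}
    (h : HasFinitelyManySimples P) : (K0.mk '' {Y | IsSimpleIn P Y}).Finite := by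
  obtain ⟨s, hs, h⟩ := h
  refine (hs.image K0.mk).subset ?_
  rintro _ ⟨X, hX, rfl⟩
  obtain ⟨Y, hY, ⟨e⟩⟩ := h X hX
  exact ⟨Y, hY, (K0.mk_congr e).symm⟩

namespace StabilityCondition

variable {σ : StabilityCondition C}

/-! ### The heart of the underlying t-structure -/

lemma HasUnderlyingTStructure.heart_iff {t : TStructure C} (hσ : σ.HasUnderlyingTStructure t)
    (X : C) : t.heart X ↔ ∀ i, (σ.hn X).phase i ∈ Set.Ioc 0 1 := by
  have e : (X⟦(-1 : ℤ)⟧)⟦(1 : ℤ)⟧ ≅ X := (shiftEquiv C (1 : ℤ)).counitIso.app X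
  have h1 : t.ge 0 X ↔ t.ge 1 (X⟦(-1 : ℤ)⟧) :=
    ⟨fun h => t.ge_shift 0 (-1) 1 (by norm_num) X h,
      fun h => (t.ge 0).prop_of_iso e (t.ge_shift 1 1 0 (by norm_num) _ h)⟩
  have h2 : t.ge 1 (X⟦(-1 : ℤ)⟧) ↔ σ.RightOrth (Set.Ioi 0) (X⟦(-1 : ℤ)⟧) := by
    rw [hσ.2, rightOrth_iff (σ.hn _) (isUpperSet_Ioi 0)]
    simp
  have h3 : σ.RightOrth (Set.Ioi 0) (X⟦(-1 : ℤ)⟧) ↔ σ.RightOrth (Set.Ioi 1) X := by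
    have hI : {ψ : ℝ | ψ + 1 ∈ Set.Ioi 1} = Set.Ioi 0 := by
      ext ψ
      simp
    rw [← hI, ← rightOrth_shift_iff]
    exact ⟨fun h => h.of_iso e, fun h => h.of_iso e.symm⟩
  have h4 : t.ge 0 X ↔ ∀ i, (σ.hn X).phase i ≤ 1 := by
    rw [h1, h2, h3, rightOrth_iff (σ.hn _) (isUpperSet_Ioi 1)]
    simp
  have h5 : t.heart X ↔ t.le 0 X ∧ t.ge 0 X := Iff.rfl
  rw [h5, h4, hσ.1]
  exact forall_and.symm

/-- The functional `c · Im Z - Re Z` on the Grothendieck group. -/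
noncomputable def slopeForm (σ : StabilityCondition C) (c : ℝ) : K0 C →+ ℝ :=
  (AddMonoidHom.mulLeft c).comp (Complex.imAddGroupHom.comp σ.Z) -
    Complex.reAddGroupHom.comp σ.Z

lemma slopeForm_apply (c : ℝ) (k : K0 C) : σ.slopeForm c k = c * (σ.Z k).im - (σ.Z k).re := rfl

/-- Vectors `exp(iπψ)` with `0 < ψ < 1` have positive imaginary part, and for `ψ = 1` the real part
is negative. -/
lemma eventually_slopeForm_pos {E : C} (hE : ¬ IsZero E)
    (h : ∀ i, (σ.hn E).phase i ∈ Set.Ioc 0 1) :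
    ∀ᶠ c in Filter.atTop, 0 < σ.slopeForm c (K0.mk E) := by
  have h1 : ∀ i, ∀ᶠ c in Filter.atTop, 0 < c * Real.sin (Real.pi * (σ.hn E).phase i) -
      Real.cos (Real.pi * (σ.hn E).phase i) := by
    intro i
    obtain ⟨h0, h1⟩ := h i
    rcases h1.eq_or_lt with h1 | h1
    · simp [h1]
    · have hs : 0 < Real.sin (Real.pi * (σ.hn E).phase i) :=
        Real.sin_pos_of_pos_of_lt_pi (by positivity) (by nlinarith [Real.pi_pos])
      filter_upwards [(Filter.tendsto_id.atTop_mul_const hs).eventually_gt_atTop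
        (Real.cos (Real.pi * (σ.hn E).phase i))] with c hc
      exact sub_pos.2 hc
  filter_upwards [Filter.eventually_all.2 h1] with c hc
  rw [slopeForm_apply, Z_eq_sum (σ.hn E), Complex.im_sum, Complex.re_sum, Finset.mul_sum,
    ← Finset.sum_sub_distrib]
  refine Finset.sum_pos (fun i _ => ?_) ⟨⟨0, n_pos_of_not_isZero _ hE⟩, Finset.mem_univ _⟩
  rw [Complex.im_ofReal_mul, Complex.re_ofReal_mul, phaseVec_re, phaseVec_im]
  have := mul_pos (norm_Z_factor_pos (σ.hn E) i) (hc i)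
  linarith

/-- The finitely many simple objects of the heart have phases bounded away from `0`, so their
central charges are in an open half-plane whose boundary line meets the upper half-plane. -/
lemma exists_slopeForm_ge {t : TStructure C} (hσ : σ.HasUnderlyingTStructure t)
    (hsimple : HasFinitelyManySimples t.heart) :
    ∃ c δ : ℝ, 0 < δ ∧ ∀ g ∈ K0.mk '' {Y | IsSimpleIn t.heart Y}, δ ≤ σ.slopeForm c g := by
  have h1 : ∀ g ∈ K0.mk '' {Y | IsSimpleIn t.heart Y},
      ∀ᶠ c in Filter.atTop, 0 < σ.slopeForm c g := by
    rintro _ ⟨Y, hY, rfl⟩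
    exact eventually_slopeForm_pos hY.2.1 ((hσ.heart_iff Y).1 hY.1)
  obtain ⟨c, hc⟩ := ((Filter.eventually_all_finite hsimple.finite_classes).2 h1).exists
  have h2 : ∀ g ∈ K0.mk '' {Y | IsSimpleIn t.heart Y},
      ∀ᶠ δ in 𝓝[>] (0 : ℝ), δ ≤ σ.slopeForm c g := fun g hg =>
    ((eventually_lt_nhds (hc g hg)).mono fun _ h => h.le).filter_mono nhdsWithin_le_nhds
  obtain ⟨δ, hδ, hpos⟩ := (((Filter.eventually_all_finite hsimple.finite_classes).2 h2).and
    self_mem_nhdsWithin).exists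
  exact ⟨c, δ, hpos, hδ⟩

lemma slopeForm_pos_of_heart {t : TStructure C} (hlength : IsFiniteLength t.heart) {c δ : ℝ}
    (hδ : 0 < δ) (hc : ∀ g ∈ K0.mk '' {Y | IsSimpleIn t.heart Y}, δ ≤ σ.slopeForm c g)
    {E : C} (hE : t.heart E) (h0 : ¬ IsZero E) : 0 < σ.slopeForm c (K0.mk E) := by
  obtain ⟨l, hl, hs, hz⟩ := (hlength E hE).exists_list
  have h1 : 0 < l.length := List.length_pos_iff.2 fun h => h0 (hz h)
  rw [← hs]
  refine lt_of_lt_of_le ?_ (length_mul_le_map_sum fun g hg => hc g (hl g hg))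
  positivity

/-- All phases of objects of the heart are bounded away from `0`; by periodicity there is a gap
above `1` as well. This replaces the inequality `φ < 1` for objects of phase `1`. -/
lemma exists_phase_gap {t : TStructure C} (hσ : σ.HasUnderlyingTStructure t)
    (hlength : IsFiniteLength t.heart) {c δ : ℝ}
    (hδ : 0 < δ) (hc : ∀ g ∈ K0.mk '' {Y | IsSimpleIn t.heart Y}, δ ≤ σ.slopeForm c g) :
    ∃ η : ℝ, 0 < η ∧ ∀ ψ, ψ < 1 + η → ∀ E, σ.P ψ E → ¬ IsZero E → ψ ≤ 1 := by
  have hcont : Continuous fun x : ℝ => c * Real.sin (Real.pi * x) - Real.cos (Real.pi * x) := by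
    fun_prop
  obtain ⟨η, hη, h⟩ := Metric.eventually_nhds_iff.1
    ((hcont.tendsto 0).eventually_lt_const (by simp : _ < (0 : ℝ)))
  -- A semistable object of phase `ψ ∈ (1, 1 + η)` is the shift of an object of the heart on which
  -- the functional is negative.
  refine ⟨min η 1, by positivity, fun ψ hψ E hE h0 => ?_⟩
  by_contra! h1
  obtain ⟨E', hE', ⟨e⟩⟩ := exists_iso_shift hE
  have h0' : ¬ IsZero E' := fun hz =>
    h0 (((isZero_shift_iff E' 1).2 hz).of_iso e)
  have hψη : ψ - 1 < η := by linarith [min_le_left η 1]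
  have hψ1 : ψ - 1 < 1 := by linarith [min_le_right η 1]
  have hheart : t.heart E' := by
    rw [hσ.heart_iff]
    intro i
    rw [phase_eq_of_mem hE']
    exact ⟨by linarith, hψ1.le⟩
  have hpos := slopeForm_pos_of_heart hlength hδ hc hheart h0'
  rw [slopeForm_apply, Z_eq_norm_mul hE' h0', Complex.im_ofReal_mul, Complex.re_ofReal_mul,
    phaseVec_re, phaseVec_im] at hpos
  have hneg := h (y := ψ - 1) (by rw [Real.dist_eq, sub_zero, abs_of_pos (by linarith)]; exact hψη)
  have := mul_neg_of_pos_of_neg (norm_Z_pos hE' h0') hneg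
  linarith

/-- The imaginary part is `≤ 0` term by term in the Harder-Narasimhan factors, and it vanishes
only if all of them have phase `φ`. -/
lemma im_mul_conj_neg {E : C} {φ b : ℝ} (hb : 0 < b) (H : HNFiltration σ.P E)
    (h : ∀ i, H.phase i ∈ Set.Ioc (φ - 1) φ) (hE : ¬ σ.P φ E) :
    (σ.Z (K0.mk E) * conj ((b : ℂ) * phaseVec φ)).im < 0 := by
  rw [Z_mul_conj_im_eq_sum H]
  have hsin : ∀ i, H.phase i < φ → Real.sin (Real.pi * (H.phase i - φ)) < 0 := fun i hi =>
    Real.sin_neg_of_neg_of_neg_pi_lt (by nlinarith [Real.pi_pos])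
      (by nlinarith [Real.pi_pos, (h i).1])
  obtain ⟨i, hi⟩ : ∃ i, H.phase i ≠ φ := by
    by_contra! hall
    exact hE (mem_of_phase_eq H hall)
  refine Finset.sum_neg' (fun i _ => ?_) ⟨i, Finset.mem_univ i, ?_⟩
  · refine mul_nonpos_of_nonneg_of_nonpos (norm_nonneg _)
      (mul_nonpos_of_nonneg_of_nonpos hb.le ?_)
    rcases (h i).2.eq_or_lt with h | h
    · simp [h]
    · exact (hsin i h).le
  · exact mul_neg_of_pos_of_neg (norm_Z_factor_pos H i)
      (mul_neg_of_pos_of_neg hb (hsin i ((h i).2.lt_of_ne hi)))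

lemma im_mul_conj_pos {E : C} {φ b : ℝ} (hb : 0 < b) (H : HNFiltration σ.P E)
    (h : ∀ i, H.phase i ∈ Set.Ico φ (φ + 1)) (hE : ¬ σ.P φ E) :
    0 < (σ.Z (K0.mk E) * conj ((b : ℂ) * phaseVec φ)).im := by
  rw [Z_mul_conj_im_eq_sum H]
  have hsin : ∀ i, φ < H.phase i → 0 < Real.sin (Real.pi * (H.phase i - φ)) := fun i hi =>
    Real.sin_pos_of_pos_of_lt_pi (by nlinarith [Real.pi_pos])
      (by nlinarith [Real.pi_pos, (h i).2])
  obtain ⟨i, hi⟩ : ∃ i, H.phase i ≠ φ := by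
    by_contra! hall
    exact hE (mem_of_phase_eq H hall)
  refine Finset.sum_pos' (fun i _ => ?_) ⟨i, Finset.mem_univ i, ?_⟩
  · refine mul_nonneg (norm_nonneg _) (mul_nonneg hb.le ?_)
    rcases (h i).1.eq_or_lt with h | h
    · simp [← h]
    · exact (hsin i h).le
  · exact mul_pos (norm_Z_factor_pos H i) (mul_pos hb (hsin i ((h i).1.lt_of_ne' hi)))

/-- Proper nonzero subobjects in the heart of a stable object have strictly smaller phase. -/
lemma im_neg_of_isSimpleIn {φ : ℝ} (hφ : φ ∈ Set.Ioc 0 1) {F : C} (hF : IsSimpleIn (σ.P φ) F)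
    {A B : C} {f : A ⟶ F} {g : F ⟶ B} {h : B ⟶ A⟦(1 : ℤ)⟧}
    (hT : Triangle.mk f g h ∈ distTriang C)
    (hA : ∀ i, (σ.hn A).phase i ∈ Set.Ioc 0 1) (hB : ∀ i, (σ.hn B).phase i ∈ Set.Ioc 0 1)
    (hA0 : ¬ IsZero A) (hB0 : ¬ IsZero B) :
    (σ.Z (K0.mk A) * conj (σ.Z (K0.mk F))).im < 0 := by
  obtain ⟨hFφ, hF0, hs⟩ := hF
  -- Morphisms to `A` from phases above `φ` die in `F`, so they come from `B⟦-1⟧`, whose phases are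
  -- at most `0`.
  have hA1 : ∀ i, (σ.hn A).phase i ∈ Set.Ioc (φ - 1) φ := by
    have hB' : σ.RightOrth (Set.Ioi 1) B := by
      rw [rightOrth_iff (σ.hn B) (isUpperSet_Ioi 1)]
      exact fun i => not_lt.2 (hB i).2
    have hA' : σ.RightOrth (Set.Ioi φ) A := by
      intro ψ hψ Y hY k
      obtain ⟨l, hl⟩ := exists_map_eq_comp_connecting hT k (σ.hom_eq_zero ψ φ hψ _ _ hY hFφ _)
      rw [← (shiftFunctor C (1 : ℤ)).map_eq_zero_iff, hl,
        hB' (ψ + 1) (by simpa using hφ.1.trans hψ) _ ((σ.shift_iff _ _).2 hY) l, zero_comp]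
    rw [rightOrth_iff (σ.hn A) (isUpperSet_Ioi φ)] at hA'
    exact fun i => ⟨by linarith [(hA i).1, hφ.2], not_lt.1 (hA' i)⟩
  -- Dually, morphisms from `B` to phases below `φ` factor through `A⟦1⟧`, whose phases exceed `1`.
  have hB1 : ∀ i, (σ.hn B).phase i ∈ Set.Ico φ (φ + 1) := by
    have hA' : σ.LeftOrth (Set.Iic 1) (A⟦(1 : ℤ)⟧) := by
      rw [leftOrth_shift_iff]
      refine leftOrth_of_phase_gt (σ.hn A) ?_
      exact fun i ψ hψ => lt_of_le_of_lt (by simpa using hψ) (hA i).1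
    have hB' : σ.LeftOrth (Set.Iio φ) B := by
      intro ψ hψ Y hY k
      obtain ⟨l, hl⟩ := exists_eq_connecting_comp hT k (σ.hom_eq_zero φ ψ hψ _ _ hFφ hY _)
      rw [hl, hA' ψ (hψ.le.trans hφ.2) _ hY l, comp_zero]
    rw [leftOrth_iff (σ.hn B) (isLowerSet_Iio φ)] at hB'
    exact fun i => ⟨not_lt.1 (hB' i), by linarith [(hB i).2, hφ.1]⟩
  have hZF := Z_eq_norm_mul hFφ hF0
  have hb := norm_Z_pos hFφ hF0
  -- If `A` is in `P(φ)` then `B` is not, as `F` is simple in `P(φ)`.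
  by_cases hAφ : σ.P φ A
  · have hBφ : ¬ σ.P φ B := fun hBφ => (hs A B f g h hT hAφ hBφ).elim hA0 hB0
    have h1 := im_mul_conj_pos hb (σ.hn B) hB1 hBφ
    rw [← hZF] at h1
    have h2 : σ.Z (K0.mk A) = σ.Z (K0.mk F) - σ.Z (K0.mk B) := by
      rw [K0.mk_triangle hT, map_add, add_sub_cancel_right]
    rw [h2, sub_mul, Complex.sub_im, Complex.mul_conj, Complex.ofReal_im]
    linarith
  · have h1 := im_mul_conj_neg hb (σ.hn A) hA1 hAφ
    rwa [← hZF] at h1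

/-! ### Destabilizing triangles -/

/-- If `F` is semistable, a triangle in `P(φ)` witnesses that it is not stable; otherwise the last
step of the Harder-Narasimhan filtration does. -/
lemma exists_destabilizing_triangle {F : C} (h0 : ¬ IsZero F) (hF : ¬ σ.IsStable F) {a b : ℝ}
    (hab : b ≤ a + 1) (ha : a < σ.phiMinus F) (hb : σ.phiPlus F < b) :
    ∃ (A B : C) (f : A ⟶ F) (g : F ⟶ B) (h : B ⟶ A⟦(1 : ℤ)⟧),
      Triangle.mk f g h ∈ distTriang C ∧ ¬ IsZero A ∧ ¬ IsZero B ∧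
      (∀ i, (σ.hn A).phase i ∈ Set.Ioo a b) ∧ (∀ i, (σ.hn B).phase i ∈ Set.Ioo a b) ∧
      0 ≤ (σ.Z (K0.mk A) * conj (σ.Z (K0.mk F))).im := by
  have hmem : ∀ i, (σ.hn F).phase i ∈ Set.Ioo a b := fun i =>
    ⟨ha.trans_le (phiMinus_le_phase F i), (phase_le_phiPlus F i).trans_lt hb⟩
  by_cases hss : ∃ φ, σ.P φ F
  · obtain ⟨φ, hFφ⟩ := hss
    have hφ : φ ∈ Set.Ioo a b := by
      have := hmem ⟨0, n_pos_of_not_isZero _ h0⟩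
      rwa [phase_eq_of_mem hFφ] at this
    have hns : ¬ IsSimpleIn (σ.P φ) F := fun h => hF ⟨φ, h⟩
    simp only [IsSimpleIn, hFφ, h0, not_false_eq_true, true_and, not_forall, not_or] at hns
    obtain ⟨A, B, f, g, h, hT, hA, hB, hA0, hB0⟩ := hns
    refine ⟨A, B, f, g, h, hT, hA0, hB0, fun i => ?_, fun i => ?_, ?_⟩
    · rwa [phase_eq_of_mem hA]
    · rwa [phase_eq_of_mem hB]
    · rw [Z_eq_norm_mul hFφ h0, Z_mul_conj_im_eq_sum (σ.hn A)]
      simp [phase_eq_of_mem hA]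
  · let H := σ.hn F
    have hn := n_pos_of_not_isZero H h0
    let j : Fin H.n := ⟨H.n - 1, by omega⟩
    have hj : j.succ = Fin.last H.n := by
      ext
      simp only [j, Fin.val_succ, Fin.val_last]
      omega
    have hle : ∀ i, H.phase j ≤ H.phase i := fun i =>
      H.phase_strictAnti.antitone (Fin.le_def.2 (by simp only [j]; omega))
    let e : H.obj j.succ ≅ F := eqToIso (by rw [hj]) ≪≫ H.isoLast
    have hT : Triangle.mk (H.ι j ≫ e.hom) (e.inv ≫ H.π j) (H.δ j) ∈ distTriang C :=
      triangle_of_iso (H.distinguished j) e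
    refine ⟨_, _, _, _, _, hT, fun hz => ?_, H.factor_ne_zero j, ?_, fun i => ?_, ?_⟩
    · have := isIso_of_isZero_left hT hz
      exact hss ⟨_, σ.prop_of_iso _ (asIso (e.inv ≫ H.π j)).symm (H.factor_mem j)⟩
    · have h1 := leftOrth_obj H (I := Set.Iic a)
        (fun i ψ hψ => lt_of_le_of_lt hψ (hmem i).1) j.castSucc
      have h2 := rightOrth_obj H (I := Set.Ici b)
        (fun i ψ hψ => lt_of_lt_of_le (hmem i).2 hψ) j.castSucc
      rw [leftOrth_iff (σ.hn _) (isLowerSet_Iic a)] at h1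
      rw [rightOrth_iff (σ.hn _) (isUpperSet_Ici b)] at h2
      exact fun i => ⟨not_le.1 (h1 i), not_le.1 (h2 i)⟩
    · rw [phase_eq_of_mem (H.factor_mem j)]
      exact hmem j
    -- `[A] = [F] - [B]`, and all factors of `F` have phase at least that of `B`.
    · have h2 : σ.Z (K0.mk (H.obj j.castSucc)) =
          σ.Z (K0.mk F) - σ.Z (K0.mk (H.factor j)) := by
        rw [K0.mk_triangle hT, map_add, add_sub_cancel_right]
      have h3 : (σ.Z (K0.mk (H.factor j)) * conj (σ.Z (K0.mk F))).im =
          -(σ.Z (K0.mk F) * conj (σ.Z (K0.mk (H.factor j)))).im := by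
        simp only [Complex.mul_im, Complex.conj_re, Complex.conj_im]
        ring
      rw [h2, sub_mul, Complex.sub_im, Complex.mul_conj, Complex.ofReal_im, h3, zero_sub, neg_neg,
        Z_eq_norm_mul (H.factor_mem j) (H.factor_ne_zero j), Z_mul_conj_im_eq_sum H]
      refine Finset.sum_nonneg fun i _ => mul_nonneg (norm_nonneg _)
        (mul_nonneg (norm_nonneg _) (Real.sin_nonneg_of_nonneg_of_le_pi ?_ ?_))
      · exact mul_nonneg Real.pi_pos.le (sub_nonneg.2 (hle i))
      · have h4 : H.phase i - H.phase j ≤ 1 := by linarith [(hmem i).2, (hmem j).1]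
        nlinarith [Real.pi_pos]

/-! ### Openness of stability -/

lemma abs_phiPlus_sub_lt {τ : StabilityCondition C} {ε : ℝ} (h : edist τ σ < ENNReal.ofReal ε)
    {E : C} (hE : ¬ IsZero E) : |τ.phiPlus E - σ.phiPlus E| < ε := by
  have := (edist_phiPlus_le τ σ hE).trans_lt h
  rwa [edist_lt_ofReal, Real.dist_eq] at this

lemma abs_phiMinus_sub_lt {τ : StabilityCondition C} {ε : ℝ} (h : edist τ σ < ENNReal.ofReal ε)
    {E : C} (hE : ¬ IsZero E) : |τ.phiMinus E - σ.phiMinus E| < ε := by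
  have := (edist_phiMinus_le τ σ hE).trans_lt h
  rwa [edist_lt_ofReal, Real.dist_eq] at this

lemma phase_mem_of_edist_lt {τ : StabilityCondition C} {ε a b : ℝ}
    (h : edist τ σ < ENNReal.ofReal ε) {E : C} (hE : ¬ IsZero E)
    (hτ : ∀ i, (τ.hn E).phase i ∈ Set.Ioo a b) (i : Fin (σ.hn E).n) :
    (σ.hn E).phase i ∈ Set.Ioo (a - ε) (b + ε) := by
  obtain ⟨j, hj⟩ := exists_phase_eq_phiPlus (σ := τ) hE
  obtain ⟨k, hk⟩ := exists_phase_eq_phiMinus (σ := τ) hE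
  have h1 := abs_lt.1 (abs_phiPlus_sub_lt h hE)
  have h2 := abs_lt.1 (abs_phiMinus_sub_lt h hE)
  have h3 := phase_le_phiPlus (σ := σ) E i
  have h4 := phiMinus_le_phase (σ := σ) E i
  have h5 := (hτ j).2
  have h6 := (hτ k).1
  constructor <;> linarith [h1.1, h2.2]

/-- Openness of stability for an object of the heart. -/
lemma eventually_isStable {t : TStructure C} (hlength : IsFiniteLength t.heart)
    (hsimple : HasFinitelyManySimples t.heart) (hσ : σ.HasUnderlyingTStructure t)
    {φ : ℝ} (hφ : φ ∈ Set.Ioc 0 1) {F : C} (hF : IsSimpleIn (σ.P φ) F) :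
    ∀ᶠ τ in 𝓝 σ, τ.IsStable F := by
  obtain ⟨c, δ, hδ, hc⟩ := exists_slopeForm_ge hσ hsimple
  obtain ⟨η, hη, hgap⟩ := exists_phase_gap hσ hlength hδ hc
  have hT := finite_sums_of_le hsimple.finite_classes hδ hc (σ.slopeForm c (K0.mk F))
  obtain ⟨ε, hε, hε1, hε2, hε3⟩ : ∃ ε : ℝ, 0 < ε ∧ 2 * ε ≤ φ ∧ 2 * ε ≤ η ∧ 2 * ε ≤ 1 := by
    refine ⟨min φ (min η 1) / 2, ?_, ?_, ?_, ?_⟩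
    · have := lt_min hφ.1 (lt_min hη one_pos)
      positivity
    · linarith [min_le_left φ (min η 1)]
    · linarith [min_le_right φ (min η 1), min_le_left η 1]
    · linarith [min_le_right φ (min η 1), min_le_right η 1]
  have hev1 : ∀ᶠ τ in 𝓝 σ, edist τ σ < ENNReal.ofReal ε :=
    Metric.eball_mem_nhds σ (ENNReal.ofReal_pos.2 hε)
  have hev2 : ∀ᶠ τ in 𝓝 σ, ∀ k ∈ {k | σ.slopeForm c k ≤ σ.slopeForm c (K0.mk F) ∧
      ∃ l : List (K0 C), (∀ g ∈ l, g ∈ K0.mk '' {Y | IsSimpleIn t.heart Y}) ∧ l.sum = k},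
      (σ.Z k * conj (σ.Z (K0.mk F))).im < 0 → (τ.Z k * conj (τ.Z (K0.mk F))).im < 0 := by
    refine (Filter.eventually_all_finite hT).2 fun k _ => ?_
    by_cases hk : (σ.Z k * conj (σ.Z (K0.mk F))).im < 0
    · have hcont : Continuous fun τ : StabilityCondition C =>
          (τ.Z k * conj (τ.Z (K0.mk F))).im :=
        Complex.continuous_im.comp
          ((continuous_Z k).mul (Complex.continuous_conj.comp (continuous_Z _)))
      filter_upwards [(hcont.tendsto σ).eventually_lt_const hk] with τ hτ _
      exact hτ
    · exact Filter.Eventually.of_forall fun τ h => absurd h hk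
  filter_upwards [hev1, hev2] with τ hτ1 hτ2
  by_contra hns
  have hFp := abs_lt.1 (abs_phiPlus_sub_lt hτ1 hF.2.1)
  have hFm := abs_lt.1 (abs_phiMinus_sub_lt hτ1 hF.2.1)
  rw [phiPlus_eq_of_mem hF.1 hF.2.1] at hFp
  rw [phiMinus_eq_of_mem hF.1 hF.2.1] at hFm
  obtain ⟨A, B, f, g, h, hdist, hA0, hB0, hA, hB, him⟩ :=
    exists_destabilizing_triangle (a := φ - ε) (b := φ + ε) hF.2.1 hns (by linarith)
      (by linarith) (by linarith)
  have hin : ∀ E : C, ¬ IsZero E → (∀ i, (τ.hn E).phase i ∈ Set.Ioo (φ - ε) (φ + ε)) →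
      ∀ i, (σ.hn E).phase i ∈ Set.Ioc 0 1 := by
    intro E hE0 hE i
    have hi := phase_mem_of_edist_lt hτ1 hE0 hE i
    exact ⟨by linarith [hi.1], hgap _ (by linarith [hi.2, hφ.2]) _ ((σ.hn E).factor_mem i)
      ((σ.hn E).factor_ne_zero i)⟩
  have hA' := hin A hA0 hA
  have hB' := hin B hB0 hB
  obtain ⟨l, hl, hs, -⟩ := (hlength A ((hσ.heart_iff A).2 hA')).exists_list
  refine not_lt.2 him (hτ2 (K0.mk A) ⟨?_, l, hl, hs⟩
    (im_neg_of_isSimpleIn hφ hF hdist hA' hB' hA0 hB0))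
  -- The value of the functional on `A` is at most that on `F`, as it is positive on `B`.
  have := slopeForm_pos_of_heart hlength hδ hc ((hσ.heart_iff B).2 hB') hB0
  rw [K0.mk_triangle hdist, map_add]
  linarith

end StabilityCondition

end BridgelandStability

open BridgelandStability StabilityCondition in
theorem mainTheorem3 {C : Type*} [Category* C]
    [CategoryTheory.Limits.HasZeroObject C] [CategoryTheory.HasShift C ℤ]
    [CategoryTheory.Preadditive C]
    [∀ n : ℤ, (CategoryTheory.shiftFunctor C n).Additive]
    [CategoryTheory.Pretriangulated C] [CategoryTheory.IsTriangulated C]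
    (t : CategoryTheory.Triangulated.TStructure C)
    (hlength : BridgelandStability.IsFiniteLength t.heart)
    (hsimple : BridgelandStability.HasFinitelyManySimples t.heart)
    (σ : BridgelandStability.StabilityCondition C)
    (hσ : σ.HasUnderlyingTStructure t)
    (F : C) (hF : σ.IsStable F) :
    ∃ U : Set (BridgelandStability.StabilityCondition C), IsOpen U ∧ σ ∈ U ∧
      ∀ σ' ∈ U, σ'.IsStable F := by
  obtain ⟨φ, hφ⟩ := hF
  -- The shift by `n` moves the phase of `F` into the interval `(0, 1]` of the heart.
  let n : ℤ := 1 - ⌈φ⌉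
  have hn : φ + n ∈ Set.Ioc (0 : ℝ) 1 := by
    have h1 := Int.le_ceil φ
    have h2 := Int.ceil_lt_add_one φ
    simp only [n, Int.cast_sub, Int.cast_one]
    constructor <;> linarith
  have hF' : IsSimpleIn (σ.P (φ + n)) (F⟦n⟧) := by
    obtain ⟨ψ, hψ⟩ := (isStable_shift_iff n).2 ⟨φ, hφ⟩
    have : ψ = φ + n := by
      rw [← phiPlus_eq_of_mem hψ.1 hψ.2.1,
        phiPlus_eq_of_mem ((mem_shift_iff φ F n).2 hφ.1) hψ.2.1]
    rwa [← this]
  obtain ⟨U, hU, hUo, hσU⟩ := mem_nhds_iff.1 (eventually_isStable hlength hsimple hσ hn hF')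
  exact ⟨U, hUo, hσU, fun σ' h => (isStable_shift_iff n).1 (hU h)⟩
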